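/- All graphs are finite, undirected and simple; classes of graphs are arbitrary. For a graph $G$ and $r\in\mathbb{N}$, the $r$-th power $G^r$ has vertex set $V(G)$, and two distinct vertices are adjacent in $G^r$ iff their distance in $G$ is at most $r$. A graph $H$ is a shallow minor of $G$ at depth $d$ if there are pairwise disjoint vertex sets $B_h\subseteq V(G)$ $(h\in V(H))$, each inducing a connected subgraph of radius at most $d$, such that for every edge $hh'$ of $H$ there is an edge of $G$ between $B_h$ and $B_{h'}$. A class $\mathcal{C}$ of graphs has bounded expansion if there is a function $f\colon\mathbb{N}\to\mathbb{R}$ such that $|E(H)|\le f(d)\,|V(H)|$ for all $d\in\mathbb{N}$, all $G\in\mathcal{C}$ and all shallow minors $H$ of $G$ at depth $d$. For $X\subseteq V(G)$, the cut-rank $\mathrm{cutrk}_G(X)$ is the rank over the two-element field of the submatrix of the adjacency matrix of $G$ with rows $X$ and columns $V(G)\setminus X$ (and $0$ if $X=\emptyset$ or $X=V(G)$). A rank-decomposition of $G$ is a pair $(T,L)$, where $T$ is a finite tree with at least two nodes, all of degree $1$ or $3$, and $L$ is a bijection from $V(G)$ to the set of leaves of $T$. The width of an edge $e$ of $T$ is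 $\mathrm{cutrk}_G(A)$, where $A$ is the set of vertices mapped by $L$ into one of the two components of $T-e$ (the choice does not matter); the width of $(T,L)$ is the maximum width of its edges, and the rank-width of $G$ is the minimum width of a rank-decomposition of $G$, or $0$ if $|V(G)|\le 1$. A class $\mathcal{D}$ of graphs admits low rank-width colorings if there are functions $N,Q\colon\mathbb{N}\to\mathbb{N}$ such that for every $p\in\mathbb{N}$, every $G\in\mathcal{D}$ has a (not necessarily proper) vertex coloring with at most $N(p)$ colors such that for every $i\le p$ the union of any $i$ color classes induces a subgraph of $G$ of rank-width at most $Q(i)$. **Theorem.** Let $\mathcal{C}$ be a class of graphs of bounded expansion and let $r\ge 2$ be an integer. Then the class $\{G^r : G\in\mathcal{C}\}$ admits low rank-width colorings. -/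

import Mathlib

universe u

/-- A finite simple graph (undirected, without loops or parallel edges). -/
structure FinGraph where
  V : Type u
  [finite : Finite V]
  graph : SimpleGraph V

attribute [instance] FinGraph.finite

/-- The `r`-th power of a graph: same vertices, and two distinct vertices are adjacent iff their
distance (which is `⊤` in different components) is at most `r`. -/
def SimpleGraph.distPower {V : Type u} (G : SimpleGraph V) (r : ℕ) : SimpleGraph V where
  Adj a b := a ≠ b ∧ G.edist a b ≤ (r : ℕ∞)
  symm := ⟨fun a b h => ⟨h.1.symm, by rw [SimpleGraph.edist_comm]; exact h.2⟩⟩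
  loopless := ⟨fun _ h => h.1 rfl⟩

/-- The `r`-th power, as a finite graph. -/
def FinGraph.power (r : ℕ) (G : FinGraph.{u}) : FinGraph.{u} where
  V := G.V
  graph := G.graph.distPower r

/-- `H` is a shallow minor of `G` at depth `d`: there are pairwise disjoint vertex sets `B h`
(branch sets) of `G`, one for each vertex `h` of `H`, each inducing a connected subgraph of radius
at most `d` (so each contains a centre), such that adjacent vertices of `H` have branch sets
joined by an edge of `G`. -/
def FinGraph.IsShallowMinor (d : ℕ) (H G : FinGraph.{u}) : Prop :=
  ∃ B : H.V → Set G.V,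
    (∀ h h' : H.V, h ≠ h' → Disjoint (B h) (B h')) ∧
    (∀ h : H.V, ∃ c : B h, ∀ x : B h, (G.graph.induce (B h)).edist c x ≤ (d : ℕ∞)) ∧
    (∀ h h' : H.V, H.graph.Adj h h' → ∃ x ∈ B h, ∃ y ∈ B h', G.graph.Adj x y)

/-- A class of graphs has bounded expansion if for every depth `d` the edge density `|E(H)| / |V(H)|`
of the depth-`d` shallow minors `H` of its members is bounded by a constant `f d`. -/
def BoundedExpansion (C : Set FinGraph.{u}) : Prop :=
  ∃ f : ℕ → ℝ, ∀ d : ℕ, ∀ G ∈ C, ∀ H : FinGraph.{u}, H.IsShallowMinor d G →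
    (H.graph.edgeSet.ncard : ℝ) ≤ f d * (Nat.card H.V : ℝ)

open Classical in
/-- The cut-rank of a vertex set `X`: the rank over the binary field of the submatrix of the
adjacency matrix with rows `X` and columns the complement of `X`. -/
noncomputable def SimpleGraph.cutRank {V : Type u} [Finite V] (G : SimpleGraph V) (X : Set V) : ℕ :=
  letI : Fintype V := Fintype.ofFinite V
  ((G.adjMatrix (ZMod 2)).submatrix (fun x : X => (x : V)) (fun y : (Xᶜ : Set V) => (y : V))).rank

/-- A rank-decomposition of a graph with vertex set `V`: a finite tree with at least two nodes, all of
degree 1 or 3, with a bijection from `V` to the leaves (the nodes of degree 1). -/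
structure RankDecomposition (V : Type u) where
  node : Type
  [finite : Finite node]
  tree : SimpleGraph node
  isTree : tree.IsTree
  two_le_card : 2 ≤ Nat.card node
  degree_eq : ∀ t : node, (tree.neighborSet t).ncard = 1 ∨ (tree.neighborSet t).ncard = 3
  leafEquiv : V ≃ {t : node // (tree.neighborSet t).ncard = 1}

/-- The vertices mapped to leaves lying in the component of `a` after deletion of the edge `ab`. -/
def RankDecomposition.side {V : Type u} (D : RankDecomposition V) (a b : D.node) : Set V :=
  {v | (D.tree.deleteEdges {s(a, b)}).Reachable a (D.leafEquiv v : D.node)}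

/-- The width of a rank-decomposition of `G`: the maximum over the tree edges of the cut-rank of the
induced vertex bipartition (cut-rank takes the same value on both sides). -/
noncomputable def RankDecomposition.width {V : Type u} [Finite V] (D : RankDecomposition V)
    (G : SimpleGraph V) : ℕ∞ :=
  ⨆ (a : D.node) (b : D.node) (_ : D.tree.Adj a b), (G.cutRank (D.side a b) : ℕ∞)

open Classical in
/-- The rank-width: the minimum width of a rank-decomposition, and `0` if there is at most one
vertex. -/
noncomputable def SimpleGraph.rankWidth {V : Type u} [Finite V] (G : SimpleGraph V) : ℕ∞ :=
  if Nat.card V ≤ 1 then 0 else ⨅ D : RankDecomposition V, D.width G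

/-- A class of graphs admits low rank-width colorings: there are functions `N` and `Q` such that for
every `p`, every graph of the class has a vertex coloring (not necessarily proper) with colors from a
set of size `N p` for which the union of any `i ≤ p` color classes induces a subgraph of rank-width
at most `Q i`. -/
def AdmitsLowRankWidthColorings (C : Set FinGraph.{u}) : Prop :=
  ∃ N Q : ℕ → ℕ, ∀ p : ℕ, ∀ G ∈ C, ∃ c : G.V → Fin (N p),
    ∀ I : Finset (Fin (N p)), I.card ≤ p →
      (G.graph.induce {v | c v ∈ I}).rankWidth ≤ (Q I.card : ℕ∞)

/-! Rank the vertices injectively. The lowest vertex of a walk of length at most `r` is weakly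
`r`-reachable from both ends. If every vertex weakly reaches at most `M` vertices
(`BoundedExpansion.exists_ranking`), let the closure of `v` consist of fixed shortest walks from `v`
to the vertices it weakly reaches. Closures have at most `M * (r + 1)` vertices, and every distance
at most `r` is realised inside the closures of its two ends (`exists_closure`).

Now colour `G` so that vertices differ whenever one weakly reaches the other within a much longer
length, and give `v`, as a vertex of the power, the set of colours in its closure. If `X` shows at
most `p` such sets, the union `Y` of its closures has at most `t = p * (M * (r + 1))` original
colours. Long paths need many colours, so in each connected piece of `Y` the lowest vertex has a
unique colour. Removing it and recursing, as for tree-depth, yields a linear order of `Y` in which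
every cut has at most `t` boundary vertices (`exists_ranking_cutBoundary_le`). Short walks across a
cut pass through its boundary, so adjacency in the power across the cut depends only on walk lengths
to the boundary. There are boundedly many distinct rows, and a caterpillar along the order has
bounded width (`rankWidth_induce_distPower_le`).

The ranking comes from sparsity of shallow minors: a maximal minor model on a set `S` exposes a
vertex of `S` whose short walks to the rest of `S` are hit by a bounded set
(`MinorSparse.exists_hitting`). This vertex is ranked last, and the argument repeats on the rest. -/

/-! ### Bounding and symmetry of cut-rank. -/

/-- Distinct rows bound the rank. -/
theorem Matrix.rank_le_card_of_row_factor {m n F : Type*} [Fintype m] [Fintype n] [Fintype F]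
    (A : Matrix m n (ZMod 2)) (φ : m → F) (B : F → n → ZMod 2) (h : ∀ x y, A x y = B (φ x) y) :
    A.rank ≤ Fintype.card F := by
  classical
  have hA : A = (Matrix.of fun x s => if φ x = s then (1 : ZMod 2) else 0) * (Matrix.of B) := by
    ext x y
    simp [Matrix.mul_apply, h]
  rw [hA]
  exact (Matrix.rank_mul_le_right _ _).trans (Matrix.rank_le_card_height _)

/-- Vertices of `X` with the same type `φ` have equal rows, so the rank is at most the number of
types. -/
theorem SimpleGraph.cutRank_le_card {V : Type u} [Finite V] (G : SimpleGraph V) (X : Set V)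
    {F : Type*} [Fintype F] (φ : V → F) (P : F → V → Prop)
    (h : ∀ x ∈ X, ∀ y ∉ X, G.Adj x y ↔ P (φ x) y) : G.cutRank X ≤ Fintype.card F := by
  classical
  unfold SimpleGraph.cutRank
  let _ : Fintype V := Fintype.ofFinite V
  refine Matrix.rank_le_card_of_row_factor _ (fun x : X => φ x)
    (fun s y => if P s y then 1 else 0) ?_
  intro x y
  simp [SimpleGraph.adjMatrix_apply, h x x.2 y y.2]

theorem Matrix.rank_eq_of_transpose_reindex {m n m' n' : Type*} [Finite m] {_ : Fintype n}
    {_ : Fintype n'} (A : Matrix m n (ZMod 2)) (B : Matrix m' n' (ZMod 2)) (e : m' ≃ n) (e' : n' ≃ m)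
    (h : ∀ x y, B x y = A (e' y) (e x)) : B.rank = A.rank := by
  have := Fintype.ofFinite m
  have hB : B = A.transpose.submatrix e e' := by
    ext x y
    simp [h]
  rw [hB, Matrix.rank_submatrix, Matrix.rank_transpose]

theorem SimpleGraph.cutRank_compl {V : Type u} [Finite V] (G : SimpleGraph V) (X : Set V) :
    G.cutRank Xᶜ = G.cutRank X := by
  classical
  unfold SimpleGraph.cutRank
  let _ : Fintype V := Fintype.ofFinite V
  refine Matrix.rank_eq_of_transpose_reindex _ _ (Equiv.refl _)
    (Equiv.setCongr (compl_compl X)) ?_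
  intro x y
  simp [SimpleGraph.adjMatrix_apply, G.adj_comm]

theorem SimpleGraph.cutRank_singleton_le {V : Type u} [Finite V] (G : SimpleGraph V) (v : V) :
    G.cutRank {v} ≤ 1 := by
  refine (G.cutRank_le_card {v} (F := Unit) (fun _ => ()) (fun _ y => G.Adj v y) ?_)
  rintro x rfl y -
  rfl

/-! ### Caterpillars: rank-decompositions along a linear order. -/

namespace RankDecomposition

/-- Since only the edge `ab` crosses the boundary of `A`, membership in `A` is constant on
components after its deletion; and every node still reaches `a` or `b`, so there are no further
components. -/
theorem side_eq {V : Type u} (D : RankDecomposition V) {a b : D.node}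
    (A : Set D.node) (haA : a ∈ A) (hbA : b ∉ A)
    (hA : ∀ x y, D.tree.Adj x y → s(x, y) ≠ s(a, b) → (x ∈ A ↔ y ∈ A)) :
    D.side a b = {v | (D.leafEquiv v : D.node) ∈ A} := by
  have inv : ∀ x y, (D.tree.deleteEdges {s(a, b)}).Reachable x y → (x ∈ A ↔ y ∈ A) := by
    rintro x y ⟨w⟩
    induction w with
    | nil => rfl
    | cons h _ ih =>
      rw [SimpleGraph.deleteEdges_adj] at h
      exact (hA _ _ h.1 h.2).trans ih
  have cov : ∀ x, (D.tree.deleteEdges {s(a, b)}).Reachable a x ∨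
      (D.tree.deleteEdges {s(a, b)}).Reachable b x := by
    intro x
    obtain ⟨w⟩ := D.isTree.1.preconnected x a
    induction w with
    | nil => exact Or.inl .rfl
    | @cons x y c h p ih =>
      by_cases he : s(x, y) = s(c, b)
      · rcases Sym2.eq_iff.1 he with h' | h'
        · exact Or.inl (h'.1 ▸ .rfl)
        · exact Or.inr (h'.1 ▸ .rfl)
      · have h2 : (D.tree.deleteEdges {s(c, b)}).Adj y x := by
          rw [SimpleGraph.deleteEdges_adj]
          exact ⟨h.symm, fun h' => he (Sym2.eq_swap.trans h')⟩
        exact (ih haA hA inv).imp (fun r => r.trans h2.reachable) (fun r => r.trans h2.reachable)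
  ext v
  constructor
  · intro hv
    exact (inv _ _ hv).1 haA
  · intro hv
    rcases cov (D.leafEquiv v) with h | h
    · exact h
    · exact absurd ((inv _ _ h).2 hv) hbA

end RankDecomposition

/-- `a` is a non-root node of the caterpillar with parent `b`: even nodes hang below their
predecessor, and the odd nodes form the spine. -/
def CaterpillarParent (a b : ℕ) : Prop := 0 < a ∧ (a % 2 = 0 ∧ b + 1 = a ∨ a % 2 = 1 ∧ b = a - 2)

/-- The caterpillar with `2 * N + 2` nodes, all of degree `1` or `3`. -/
def caterpillar (N : ℕ) : SimpleGraph (Fin (2 * N + 2)) where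
  Adj a b := CaterpillarParent a b ∨ CaterpillarParent b a
  symm := ⟨fun _ _ h => h.symm⟩
  loopless := ⟨fun a h => by unfold CaterpillarParent at h; omega⟩

/-- The nodes of the branch of the caterpillar at `j`. -/
def caterpillarBranch (N j : ℕ) : Set (Fin (2 * N + 2)) :=
  {x | if j % 2 = 0 then x.val = j else j ≤ x.val}

theorem mem_caterpillarBranch (N : ℕ) (a : Fin (2 * N + 2)) : a ∈ caterpillarBranch N a := by
  simp [caterpillarBranch]

theorem notMem_caterpillarBranch {N : ℕ} {a b : Fin (2 * N + 2)} (h : CaterpillarParent a b) :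
    b ∉ caterpillarBranch N a := by
  simp only [CaterpillarParent] at h
  simp only [caterpillarBranch, Set.mem_ofPred_eq]
  split_ifs <;> omega

/-- The parent edge is the only edge leaving a branch. This gives both acyclicity and the two sides
of every tree edge. -/
theorem caterpillarBranch_iff {N : ℕ} {a b : Fin (2 * N + 2)} (hab : CaterpillarParent a b)
    (x y : Fin (2 * N + 2)) (h : (caterpillar N).Adj x y) (hne : s(x, y) ≠ s(a, b)) :
    x ∈ caterpillarBranch N a ↔ y ∈ caterpillarBranch N a := by
  have hne' : ¬ (x.val = a.val ∧ y.val = b.val) ∧ ¬ (x.val = b.val ∧ y.val = a.val) := by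
    constructor
    · rintro ⟨h1, h2⟩
      exact hne (by rw [Fin.ext h1, Fin.ext h2])
    · rintro ⟨h1, h2⟩
      exact hne (by rw [Fin.ext h1, Fin.ext h2, Sym2.eq_swap])
  simp only [caterpillar, CaterpillarParent] at h hab
  simp only [caterpillarBranch, Set.mem_ofPred_eq]
  split_ifs <;> omega

theorem caterpillar_isTree (N : ℕ) : (caterpillar N).IsTree := by
  constructor
  · have h0 : ∀ n, ∀ x : Fin (2 * N + 2), x.val = n → (caterpillar N).Reachable x 0 := by
      intro n
      induction n using Nat.strong_induction_on with
      | _ n ih =>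
        intro x hx
        by_cases hn : n = 0
        · have : x = 0 := Fin.ext (by simp [hx, hn])
          rw [this]
        · have hlt := x.2
          -- For `n = 1` truncated subtraction gives the root `0`, which is itself a leaf at the end
          -- of the spine.
          let p : ℕ := if n % 2 = 0 then n - 1 else n - 2
          have hp : p < n := by simp only [p]; split_ifs <;> omega
          have hadj : (caterpillar N).Adj x ⟨p, by omega⟩ := by
            left
            simp only [CaterpillarParent, p, hx]
            split_ifs <;> omega
          exact hadj.reachable.trans (ih p hp _ rfl)
    have : Nonempty (Fin (2 * N + 2)) := ⟨0⟩
    exact ⟨fun x y => (h0 _ x rfl).trans (h0 _ y rfl).symm⟩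
  · rw [SimpleGraph.isAcyclic_iff_forall_adj_isBridge]
    have key : ∀ v w : Fin (2 * N + 2), CaterpillarParent v w → (caterpillar N).IsBridge s(v, w) := by
      intro v w h
      rw [SimpleGraph.isBridge_iff]
      rintro ⟨p⟩
      have inv : ∀ x y, ((caterpillar N).deleteEdges {s(v, w)}).Walk x y →
          (x ∈ caterpillarBranch N v ↔ y ∈ caterpillarBranch N v) := by
        intro x y q
        induction q with
        | nil => rfl
        | cons h' _ ih =>
          rw [SimpleGraph.deleteEdges_adj] at h'
          exact (caterpillarBranch_iff h _ _ h'.1 h'.2).trans ih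
      exact notMem_caterpillarBranch h ((inv v w p).1 (mem_caterpillarBranch N v))
    intro v w h
    rcases h with h | h
    · exact key v w h
    · rw [Sym2.eq_swap]
      exact key w v h

theorem caterpillar_ncard_eq_one {N : ℕ} {t : Fin (2 * N + 2)}
    (ht : t.val % 2 = 0 ∨ t.val = 2 * N + 1) : ((caterpillar N).neighborSet t).ncard = 1 := by
  have hlt := t.2
  rw [Set.ncard_eq_one]
  refine ⟨⟨if t.val = 0 then 1 else if t.val % 2 = 0 then t.val - 1 else t.val - 2,
    by split_ifs <;> omega⟩, ?_⟩
  ext x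
  have hx := x.2
  simp only [SimpleGraph.mem_neighborSet, caterpillar, CaterpillarParent, Set.mem_singleton_iff,
    Fin.ext_iff]
  split_ifs <;> omega

theorem caterpillar_ncard_eq_three {N : ℕ} {t : Fin (2 * N + 2)}
    (ht : ¬ (t.val % 2 = 0 ∨ t.val = 2 * N + 1)) :
    ((caterpillar N).neighborSet t).ncard = 3 := by
  have hlt := t.2
  rw [Set.ncard_eq_three]
  refine ⟨⟨t.val - 2, by omega⟩, ⟨t.val + 1, by omega⟩, ⟨t.val + 2, by omega⟩,
    ?_, ?_, ?_, ?_⟩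
  · simp only [ne_eq, Fin.ext_iff]; omega
  · simp only [ne_eq, Fin.ext_iff]; omega
  · simp only [ne_eq, Fin.ext_iff]; omega
  ext x
  have hx := x.2
  simp only [SimpleGraph.mem_neighborSet, caterpillar, CaterpillarParent, Set.mem_singleton_iff,
    Set.mem_insert_iff, Fin.ext_iff]
  omega

theorem caterpillar_ncard_eq_one_iff {N : ℕ} {t : Fin (2 * N + 2)} :
    ((caterpillar N).neighborSet t).ncard = 1 ↔ t.val % 2 = 0 ∨ t.val = 2 * N + 1 := by
  by_cases h : t.val % 2 = 0 ∨ t.val = 2 * N + 1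
  · simp [caterpillar_ncard_eq_one h, h]
  · simp [caterpillar_ncard_eq_three h, h]

/-- The leaves of the caterpillar in their linear order. -/
noncomputable def caterpillarLeaf (N : ℕ) :
    Fin (N + 2) ≃ {t : Fin (2 * N + 2) // ((caterpillar N).neighborSet t).ncard = 1} :=
  Equiv.ofBijective
    (fun i => ⟨⟨if i.val < N + 1 then 2 * i.val else 2 * N + 1, by split_ifs <;> omega⟩,
      caterpillar_ncard_eq_one_iff.2 (by dsimp only; split_ifs <;> omega)⟩) <| by
    constructor
    · intro i j h
      have hi := i.2
      have hj := j.2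
      simp only [Subtype.mk.injEq, Fin.mk.injEq] at h
      apply Fin.ext
      split_ifs at h <;> omega
    · rintro ⟨t, ht⟩
      rw [caterpillar_ncard_eq_one_iff] at ht
      have hlt := t.2
      refine ⟨⟨if t.val % 2 = 0 then t.val / 2 else N + 1, by split_ifs <;> omega⟩, ?_⟩
      simp only [Subtype.mk.injEq, Fin.ext_iff]
      split_ifs <;> omega

theorem caterpillarLeaf_val (N : ℕ) (i : Fin (N + 2)) :
    (caterpillarLeaf N i : Fin (2 * N + 2)).val = if i.val < N + 1 then 2 * i.val else 2 * N + 1 :=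
  rfl

/-- The rank-decomposition along a linear order of the vertices. -/
noncomputable def linearRankDecomposition {V : Type u} {N : ℕ} (e : V ≃ Fin (N + 2)) :
    RankDecomposition V where
  node := Fin (2 * N + 2)
  tree := caterpillar N
  isTree := caterpillar_isTree N
  two_le_card := by simp
  degree_eq t := by
    by_cases h : t.val % 2 = 0 ∨ t.val = 2 * N + 1
    · exact Or.inl (caterpillar_ncard_eq_one h)
    · exact Or.inr (caterpillar_ncard_eq_three h)
  leafEquiv := e.trans (caterpillarLeaf N)

theorem linearRankDecomposition_side {V : Type u} {N : ℕ} (e : V ≃ Fin (N + 2))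
    {a b : Fin (2 * N + 2)} (h : CaterpillarParent a b) :
    (linearRankDecomposition e).side a b =
        {v | ((caterpillarLeaf N (e v)) : Fin (2 * N + 2)) ∈ caterpillarBranch N a} ∧
      (linearRankDecomposition e).side b a =
        {v | ((caterpillarLeaf N (e v)) : Fin (2 * N + 2)) ∈ caterpillarBranch N a}ᶜ := by
  have ha := mem_caterpillarBranch N a
  have hb := notMem_caterpillarBranch h
  constructor
  · exact (linearRankDecomposition e).side_eq _ ha hb (caterpillarBranch_iff h)
  · refine (linearRankDecomposition e).side_eq (caterpillarBranch N a)ᶜ hb (not_not.2 ha) ?_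
    intro x y hxy hne
    exact not_congr (caterpillarBranch_iff h x y hxy (by rwa [Sym2.eq_swap (a := a)]))

/-- A linear order of the vertices all of whose initial segments have small cut-rank bounds the
rank-width. -/
theorem SimpleGraph.rankWidth_le_of_equiv {V : Type u} [Finite V] (G : SimpleGraph V) {n : ℕ}
    (e : V ≃ Fin n) {k : ℕ} (hk : 1 ≤ k) (h : ∀ i : ℕ, G.cutRank {v | (e v).val < i} ≤ k) :
    G.rankWidth ≤ k := by
  unfold SimpleGraph.rankWidth
  split_ifs with hc
  · exact bot_le
  have hn : 2 ≤ n := by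
    rw [Nat.card_congr e, Nat.card_fin] at hc
    omega
  obtain ⟨N, rfl⟩ := Nat.exists_eq_add_of_le' hn
  refine (iInf_le _ (linearRankDecomposition e)).trans ?_
  have key : ∀ a : Fin (2 * N + 2), 0 < a.val →
      G.cutRank {v | ((caterpillarLeaf N (e v)) : Fin (2 * N + 2)) ∈ caterpillarBranch N a} ≤ k := by
    intro a ha
    have hlt := a.2
    by_cases h0 : a.val % 2 = 0
    · refine le_trans (le_of_eq ?_)
        ((G.cutRank_singleton_le (e.symm ⟨a.val / 2, by omega⟩)).trans hk)
      congr 1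
      ext v
      have := (e v).2
      simp only [caterpillarBranch, Set.mem_ofPred_eq, caterpillarLeaf_val, Set.mem_singleton_iff,
        Equiv.eq_symm_apply, Fin.ext_iff, if_pos h0]
      split_ifs <;> omega
    -- The branch at an odd node carries a final segment of leaves, so its complement is an initial
    -- segment.
    · rw [← G.cutRank_compl]
      refine le_trans (le_of_eq ?_) (h ((a.val + 1) / 2))
      congr 1
      ext v
      have := (e v).2
      simp only [caterpillarBranch, Set.mem_ofPred_eq, caterpillarLeaf_val, if_neg h0,
        Set.mem_compl_iff]
      split_ifs <;> omega
  unfold RankDecomposition.width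
  refine iSup_le fun a => iSup_le fun b => iSup_le fun hab => ?_
  rcases hab with hab | hab
  · rw [(linearRankDecomposition_side e hab).1]
    exact_mod_cast key a hab.1
  · rw [(linearRankDecomposition_side e hab).2, G.cutRank_compl]
    exact_mod_cast key b hab.1

/-! ### Sparse shallow minors and hitting sets for short walks. -/

open Classical in
/-- Every graph that is realised by touching disjoint branch sets of radius at most `d` around the
vertices of a set `U` has at most `c * |U|` ordered pairs of adjacent vertices. -/
def SimpleGraph.MinorSparse {V : Type u} (G : SimpleGraph V) (d c : ℕ) : Prop :=
  ∀ (U : Finset V) (B : V → Set V) (H : SimpleGraph V),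
    (∀ a ∈ U, ∀ b ∈ U, a ≠ b → Disjoint (B a) (B b)) →
    (∀ a ∈ U, a ∈ B a) →
    (∀ a ∈ U, ∀ x ∈ B a, ∃ w : G.Walk a x, w.length ≤ d ∧ ∀ y ∈ w.support, y ∈ B a) →
    (∀ a ∈ U, ∀ b ∈ U, H.Adj a b → ∃ x ∈ B a, ∃ y ∈ B b, G.Adj x y) →
    ((U ×ˢ U).filter fun p => H.Adj p.1 p.2).card ≤ c * U.card

theorem SimpleGraph.Walk.length_induce {V : Type u} {G : SimpleGraph V} {s : Set V} {a b : V}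
    (w : G.Walk a b) (hs : ∀ y ∈ w.support, y ∈ s) : (w.induce s hs).length = w.length := by
  induction w with
  | nil => rfl
  | cons h p ih => simp [ih]

theorem SimpleGraph.edist_induce_le {V : Type u} (G : SimpleGraph V) {s : Set V} {a b : s} {n : ℕ}
    (w : G.Walk a b) (hw : w.length ≤ n) (hs : ∀ y ∈ w.support, y ∈ s) :
    (G.induce s).edist a b ≤ n := by
  have h1 := (w.induce s hs).edist_le
  rw [w.length_induce] at h1
  exact h1.trans (by exact_mod_cast hw)

theorem BoundedExpansion.exists_minorSparse {C : Set FinGraph.{u}} (hC : BoundedExpansion C)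
    (d : ℕ) : ∃ c : ℕ, ∀ G ∈ C, G.graph.MinorSparse d c := by
  classical
  obtain ⟨f, hf⟩ := hC
  -- The factor 2 passes from edges to ordered pairs.
  refine ⟨2 * ⌈f d⌉₊, fun G hG U B H hdis hmem hrad htouch => ?_⟩
  let K : FinGraph.{u} := ⟨U, H.induce U⟩
  have hK : K.IsShallowMinor d G := by
    refine ⟨fun a => B a, ?_, ?_, ?_⟩
    · intro a b hab
      exact hdis a a.2 b b.2 (fun h => hab (Subtype.ext h))
    · intro a
      refine ⟨⟨a, hmem a a.2⟩, fun x => ?_⟩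
      obtain ⟨w, hw, hs⟩ := hrad a a.2 x x.2
      exact G.graph.edist_induce_le w hw hs
    · intro a b hab
      exact htouch a a.2 b b.2 hab
  have h1 := hf d G hG K hK
  have h2 : ((H.induce (U : Set G.V)).edgeSet.ncard : ℝ) ≤ f d * (U.card : ℝ) := by
    have h3 : Nat.card K.V = U.card := by simp [K]
    rw [h3] at h1
    exact h1
  have h3 : (H.induce (U : Set G.V)).edgeSet.ncard ≤ ⌈f d⌉₊ * U.card := by
    have := h2.trans (mul_le_mul_of_nonneg_right (Nat.le_ceil (f d)) (Nat.cast_nonneg U.card))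
    exact_mod_cast this
  have h4 := (H.induce (U : Set G.V)).dart_card_eq_twice_card_edges
  have h5 : (H.induce (U : Set G.V)).edgeSet.ncard = (H.induce (U : Set G.V)).edgeFinset.card := by
    rw [← SimpleGraph.coe_edgeFinset, Set.ncard_coe_finset]
  have h6 : ((U ×ˢ U).filter fun p => H.Adj p.1 p.2) ⊆
      (Finset.univ : Finset (H.induce (U : Set G.V)).Dart).image
        fun e => ((e.fst : G.V), (e.snd : G.V)) := by
    rintro ⟨a, b⟩ hab
    simp only [Finset.mem_filter, Finset.mem_product] at hab
    rw [Finset.mem_image]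
    exact ⟨⟨(⟨a, hab.1.1⟩, ⟨b, hab.1.2⟩), hab.2⟩, Finset.mem_univ _, rfl⟩
  have h7 := (Finset.card_le_card h6).trans Finset.card_image_le
  rw [Finset.card_univ, h4, ← h5] at h7
  calc _ ≤ _ := h7
    _ ≤ 2 * (⌈f d⌉₊ * U.card) := by omega
    _ = _ := by ring

open Classical in
/-- Hereditarily sparse graphs have large independent sets. -/
theorem SimpleGraph.exists_large_independent {V : Type u} (H : SimpleGraph V) (c : ℕ)
    (S : Finset V)
    (h : ∀ T ⊆ S, ((T ×ˢ T).filter fun p => H.Adj p.1 p.2).card ≤ c * T.card) :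
    ∃ R ⊆ S, (∀ a ∈ R, ∀ b ∈ R, ¬ H.Adj a b) ∧ S.card ≤ (c + 1) * R.card := by
  induction S using Finset.strongInduction with
  | H S ih =>
    by_cases hS : S = ∅
    · exact ⟨∅, by simp, by simp, by simp [hS]⟩
    -- By averaging some vertex has degree at most `c`; it joins the independent set and its closed
    -- neighbourhood is discarded.
    obtain ⟨v, hv, hdeg⟩ : ∃ v ∈ S, (S.filter (H.Adj v)).card ≤ c := by
      by_contra! hcon
      have h1 := h S subset_rfl
      have h2 : ((S ×ˢ S).filter fun p => H.Adj p.1 p.2).card =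
          ∑ a ∈ S, (S.filter (H.Adj a)).card := by
        simp only [Finset.card_filter, Finset.sum_product]
      rw [h2] at h1
      have h3 : ∑ _a ∈ S, c < ∑ a ∈ S, (S.filter (H.Adj a)).card :=
        Finset.sum_lt_sum_of_nonempty (Finset.nonempty_iff_ne_empty.2 hS) hcon
      rw [Finset.sum_const, smul_eq_mul, mul_comm] at h3
      omega
    let T := S.filter fun x => ¬ (x = v ∨ H.Adj v x)
    have hT : T ⊆ S := Finset.filter_subset _ _
    have hvT : v ∉ T := by simp [T]
    obtain ⟨R, hR, hind, hcard⟩ := ih T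
      (Finset.ssubset_iff_subset_ne.2 ⟨hT, fun h' => hvT (h' ▸ hv)⟩)
      (fun T' hT' => h T' (hT'.trans hT))
    have hadj : ∀ a ∈ R, ¬ H.Adj v a := fun a ha h' => by
      have := (Finset.mem_filter.1 (hR ha)).2
      exact this (Or.inr h')
    refine ⟨insert v R, Finset.insert_subset hv (hR.trans hT), ?_, ?_⟩
    · intro a ha b hb hab
      rcases Finset.mem_insert.1 ha with rfl | ha
      · rcases Finset.mem_insert.1 hb with rfl | hb
        · exact H.loopless.irrefl _ hab
        · exact hadj b hb hab
      · rcases Finset.mem_insert.1 hb with hb | hb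
        · exact hadj a ha (hb ▸ hab.symm)
        · exact hind a ha b hb hab
    · have hsub : S ⊆ insert v (S.filter (H.Adj v)) ∪ T := by
        intro x hx
        by_cases h' : x = v ∨ H.Adj v x
        · rcases h' with rfl | h'
          · simp
          · simp [hx, h']
        · exact Finset.mem_union_right _ (Finset.mem_filter.2 ⟨hx, h'⟩)
      have h1 := (Finset.card_le_card hsub).trans (Finset.card_union_le _ _)
      have h2 := Finset.card_insert_le v (S.filter (H.Adj v))
      rw [Finset.card_insert_of_notMem (fun h' => hvT (hR h')), mul_add, mul_one]
      omega

/-- There is a walk from `a` to `x` of length at most `n` all of whose vertices other than `a`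
lie in `O`. -/
def SimpleGraph.ReachIn {V : Type u} (G : SimpleGraph V) (O : Set V) (n : ℕ) (a x : V) : Prop :=
  ∃ w : G.Walk a x, w.length ≤ n ∧ ∀ y ∈ w.support, y = a ∨ y ∈ O

theorem SimpleGraph.ReachIn.refl {V : Type u} {G : SimpleGraph V} {O : Set V} {n : ℕ} (a : V) :
    G.ReachIn O n a a :=
  ⟨.nil, by simp, by simp⟩

/-- Two vertices joined by a walk with interior in `O` are joined by one that enters the second
vertex only in its last step. -/
theorem SimpleGraph.exists_reachIn_adj {V : Type u} {G : SimpleGraph V} {O : Set V} {n : ℕ}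
    {a b : V} (hab : a ≠ b) (w : G.Walk a b) (hn : w.length ≤ n)
    (hw : ∀ y ∈ w.support, y = a ∨ y = b ∨ y ∈ O) : ∃ x, G.ReachIn O n a x ∧ G.Adj x b := by
  classical
  -- Reversal exposes the step at `b`, and being a path ensures that `b` does not recur.
  obtain ⟨p, hp, hlen, hsup⟩ : ∃ p : G.Walk b a, p.IsPath ∧ p.length ≤ n ∧
      ∀ y ∈ p.support, y = a ∨ y = b ∨ y ∈ O :=
    ⟨w.bypass.reverse, w.bypass_isPath.reverse,
      by rw [SimpleGraph.Walk.length_reverse]; exact w.length_bypass_le_length.trans hn,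
      fun y hy => hw y (w.support_bypass_subset_support (by simpa using hy))⟩
  cases p with
  | nil => exact absurd rfl hab
  | @cons _ x _ h q =>
    rw [SimpleGraph.Walk.cons_isPath_iff] at hp
    refine ⟨x, ⟨q.reverse, ?_, ?_⟩, h.symm⟩
    · simp only [SimpleGraph.Walk.length_cons, SimpleGraph.Walk.length_reverse] at hlen ⊢
      omega
    · intro y hy
      have hy' : y ∈ q.support := by simpa using hy
      rcases hsup y (by simp [hy']) with h' | h' | h'
      · exact Or.inl h'
      · exact absurd (h' ▸ hy') hp.2
      · exact Or.inr h'

open Classical in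
/-- A shallow minor model of the graph `H` on the vertex set `S`, with branch sets that use few
vertices outside of `S`. -/
structure SimpleGraph.IsLinkage {V : Type u} (G : SimpleGraph V) (S : Finset V) (n : ℕ)
    (B : V → Set V) (H : SimpleGraph V) : Prop where
  disj : ∀ a ∈ S, ∀ b ∈ S, a ≠ b → Disjoint (B a) (B b)
  mem : ∀ a ∈ S, a ∈ B a
  walk : ∀ a ∈ S, ∀ x ∈ B a, ∃ w : G.Walk a x, w.length ≤ n ∧ ∀ y ∈ w.support, y ∈ B a
  touch : ∀ a ∈ S, ∀ b ∈ S, H.Adj a b → ∃ x ∈ B a, ∃ y ∈ B b, G.Adj x y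
  card : {x | x ∉ S ∧ ∃ a ∈ S, x ∈ B a}.ncard ≤
    n * ((S ×ˢ S).filter fun p => H.Adj p.1 p.2).card

theorem SimpleGraph.IsLinkage.trivial {V : Type u} (G : SimpleGraph V) (S : Finset V) (n : ℕ) :
    G.IsLinkage S n (fun a => {a}) ⊥ where
  disj a _ b _ h := by simpa using h
  mem a _ := rfl
  walk := by
    rintro a - x rfl
    exact ⟨.nil, by simp, by simp⟩
  touch a _ b _ h := h.elim
  card := by
    have : {x | x ∉ S ∧ ∃ a ∈ S, x ∈ ({a} : Set V)} = ∅ := by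
      ext x
      simp
    rw [this]
    simp

-- The vertices of the connecting walk are added to the branch set of `a`. They are reached along
-- that walk itself, so the radius bound `n` persists. At most `n` outside vertices are new, which
-- the new adjacency pays for.
open Classical in
theorem SimpleGraph.IsLinkage.extend {V : Type u} [Finite V] {G : SimpleGraph V} {S : Finset V}
    {n : ℕ} {B : V → Set V} {H : SimpleGraph V} (h : G.IsLinkage S n B H) {a b x : V}
    (ha : a ∈ S) (hb : b ∈ S) (hab : a ≠ b) (hH : ¬ H.Adj a b)
    (hr : G.ReachIn {y | y ∉ S ∧ ∀ s ∈ S, y ∉ B s} n a x) (hx : G.Adj x b) :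
    ∃ B' H', G.IsLinkage S n B' H' ∧
      ((S ×ˢ S).filter fun p => H.Adj p.1 p.2).card <
        ((S ×ˢ S).filter fun p => H'.Adj p.1 p.2).card := by
  obtain ⟨w, hlen, hsup⟩ := hr
  let N : Set V := {y | y ∈ w.support}
  let B' : V → Set V := fun s => if s = a then B a ∪ N else B s
  obtain ⟨H', hH'⟩ : ∃ H' : SimpleGraph V, H' = H ⊔ SimpleGraph.edge a b := ⟨_, rfl⟩
  have hBB' : ∀ s, B s ⊆ B' s := by
    intro s y hy
    simp only [B']
    split_ifs with hs
    · exact Or.inl (hs ▸ hy)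
    · exact hy
  have hB' : ∀ s ∈ S, ∀ y ∈ B' s, y ∈ B s ∨ (s = a ∧ y ∈ w.support ∧ y ∉ S ∧ ∀ s ∈ S, y ∉ B s) := by
    intro s hs y hy
    simp only [B'] at hy
    split_ifs at hy with hsa
    · rcases hy with hy | hy
      · exact Or.inl (hsa ▸ hy)
      · rcases hsup y hy with h' | h'
        · exact Or.inl (by rw [hsa, h']; exact h.mem _ ha)
        · exact Or.inr ⟨hsa, hy, h'⟩
    · exact Or.inl hy
  have hlt : ((S ×ˢ S).filter fun p => H.Adj p.1 p.2).card <
      ((S ×ˢ S).filter fun p => H'.Adj p.1 p.2).card := by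
    apply Finset.card_lt_card
    rw [Finset.ssubset_iff_of_subset]
    · refine ⟨(a, b), ?_, ?_⟩
      · simp [ha, hb, hH', SimpleGraph.edge_adj, hab]
      · simp [hH]
    · intro p hp
      rw [Finset.mem_filter] at hp ⊢
      exact ⟨hp.1, by rw [hH']; exact Or.inl hp.2⟩
  refine ⟨B', H', ⟨?_, ?_, ?_, ?_, ?_⟩, hlt⟩
  · intro s hs t ht hst
    rw [Set.disjoint_left]
    intro y hy1 hy2
    rcases hB' s hs y hy1 with h1 | ⟨h1, -, h1'⟩
    · rcases hB' t ht y hy2 with h2 | ⟨-, -, h2'⟩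
      · exact Set.disjoint_left.1 (h.disj s hs t ht hst) h1 h2
      · exact h2'.2 s hs h1
    · rcases hB' t ht y hy2 with h2 | ⟨h2, -⟩
      · exact h1'.2 t ht h2
      · exact hst (h1.trans h2.symm)
  · exact fun s hs => hBB' s (h.mem s hs)
  · intro s hs y hy
    rcases hB' s hs y hy with h1 | ⟨rfl, hyw, -⟩
    · obtain ⟨p, hp, hps⟩ := h.walk s hs y h1
      exact ⟨p, hp, fun z hz => hBB' s (hps z hz)⟩
    · refine ⟨w.takeUntil y hyw, (w.length_takeUntil_le_length hyw).trans hlen, fun z hz => ?_⟩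
      simp only [B', if_true]
      exact Or.inr (w.support_takeUntil_subset_support hyw hz)
  · intro s hs t ht hst
    rw [hH'] at hst
    rcases hst with hst | hst
    · obtain ⟨y, hy, z, hz, hyz⟩ := h.touch s hs t ht hst
      exact ⟨y, hBB' s hy, z, hBB' t hz, hyz⟩
    · have hxa : x ∈ B' a := by
        simp only [B', if_true]
        exact Or.inr w.end_mem_support
      rw [SimpleGraph.edge_adj] at hst
      rcases hst.1 with ⟨h1, h2⟩ | ⟨h1, h2⟩
      · rw [h1, h2]
        exact ⟨x, hxa, b, hBB' b (h.mem b hb), hx⟩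
      · rw [h1, h2]
        exact ⟨b, hBB' b (h.mem b hb), x, hxa, hx.symm⟩
  · have hsub : {x | x ∉ S ∧ ∃ a ∈ S, x ∈ B' a} ⊆
        {x | x ∉ S ∧ ∃ a ∈ S, x ∈ B a} ∪ ((w.support.tail.toFinset : Finset V) : Set V) := by
      rintro y ⟨hyS, s, hs, hy⟩
      rcases hB' s hs y hy with h1 | ⟨rfl, hyw, -⟩
      · exact Or.inl ⟨hyS, s, hs, h1⟩
      · right
        rw [w.mem_support_iff] at hyw
        rcases hyw with rfl | hyw
        · exact absurd hs hyS
        · simpa using hyw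
    have h1 := (Set.ncard_le_ncard hsub (Set.toFinite _)).trans (Set.ncard_union_le _ _)
    rw [Set.ncard_coe_finset] at h1
    have h2 : w.support.tail.toFinset.card ≤ n := by
      refine (List.toFinset_card_le _).trans ?_
      rw [List.length_tail, SimpleGraph.Walk.length_support]
      omega
    have h3 := h.card
    calc _ ≤ _ := h1
      _ ≤ n * ((S ×ˢ S).filter fun p => H.Adj p.1 p.2).card + n := add_le_add h3 h2
      _ = n * (((S ×ˢ S).filter fun p => H.Adj p.1 p.2).card + 1) := by ring
      _ ≤ _ := Nat.mul_le_mul_left _ hlt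

/-- In a graph with sparse shallow minors, every nonempty set `S` has a vertex `v` whose short walks
to other vertices of `S` are all hit by a small set. -/
theorem SimpleGraph.MinorSparse.exists_hitting {V : Type u} [Finite V] {G : SimpleGraph V}
    {k c : ℕ} (hG : G.MinorSparse (2 * k) c) {S : Finset V} (hS : S.Nonempty) :
    ∃ v ∈ S, ∃ Z : Finset V, Z.card ≤ c * ((1 + 2 * k * c) * (c + 1)) ∧
      ∀ y ∈ S, y ≠ v → ∀ w : G.Walk v y, w.length ≤ k → ∃ z ∈ w.support, z ≠ v ∧ z ∈ Z := by
  classical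
  let _ := Fintype.ofFinite V
  -- A linkage with the most adjacent pairs; by maximality non-adjacent vertices of `S` cannot be
  -- linked through unused vertices.
  obtain ⟨B, H, hL, hmax⟩ : ∃ B H, G.IsLinkage S (2 * k) B H ∧
      ∀ B' H', G.IsLinkage S (2 * k) B' H' →
        ((S ×ˢ S).filter fun p => H'.Adj p.1 p.2).card ≤
          ((S ×ˢ S).filter fun p => H.Adj p.1 p.2).card := by
    let P : Set ℕ := {m | ∃ B H, G.IsLinkage S (2 * k) B H ∧
      ((S ×ˢ S).filter fun p => H.Adj p.1 p.2).card = m}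
    have hne : P.Nonempty := ⟨_, _, _, SimpleGraph.IsLinkage.trivial G S (2 * k), rfl⟩
    have hbd : BddAbove P := by
      refine ⟨(S ×ˢ S).card, ?_⟩
      rintro m ⟨B, H, -, rfl⟩
      exact Finset.card_filter_le _ _
    obtain ⟨B, H, hL, hm⟩ := Nat.sSup_mem hne hbd
    exact ⟨B, H, hL, fun B' H' h' => hm ▸ le_csSup hbd ⟨B', H', h', rfl⟩⟩
  have hnoext : ∀ a ∈ S, ∀ b ∈ S, a ≠ b → ¬ H.Adj a b → ∀ x,
      G.ReachIn {y | y ∉ S ∧ ∀ s ∈ S, y ∉ B s} (2 * k) a x → ¬ G.Adj x b := by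
    intro a ha b hb hab hH x hr hx
    obtain ⟨B', H', h', hlt⟩ := hL.extend ha hb hab hH hr hx
    exact absurd (hmax B' H' h') (not_le.2 hlt)
  obtain ⟨R, hRS, hind, hRcard⟩ := H.exists_large_independent c S (fun T hT =>
    hG T B H (fun a ha b hb => hL.disj a (hT ha) b (hT hb)) (fun a ha => hL.mem a (hT ha))
      (fun a ha => hL.walk a (hT ha)) (fun a ha b hb => hL.touch a (hT ha) b (hT hb)))
  -- `O` is the unused part and `U` the used part, whose size is linear in `S.card` because the
  -- linkage is sparse.
  let O : Set V := {y | y ∉ S ∧ ∀ s ∈ S, y ∉ B s}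
  let U : Finset V := Finset.univ.filter fun y => y ∉ O
  have hSU : ∀ a ∈ S, a ∈ U := fun a ha =>
    Finset.mem_filter.2 ⟨Finset.mem_univ _, fun h => h.1 ha⟩
  have hUO : ∀ a ∈ U, a ∉ O := fun a ha => (Finset.mem_filter.1 ha).2
  have hUcard : U.card ≤ (1 + 2 * k * c) * S.card := by
    have h1 : (U : Set V) ⊆ (S : Set V) ∪ {x | x ∉ S ∧ ∃ a ∈ S, x ∈ B a} := by
      intro y hy
      have hyO := hUO y hy
      by_cases hyS : y ∈ S
      · exact Or.inl hyS
      · right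
        refine ⟨hyS, ?_⟩
        by_contra! hcon
        exact hyO ⟨hyS, hcon⟩
    have h2 := (Set.ncard_le_ncard h1 (Set.toFinite _)).trans (Set.ncard_union_le _ _)
    rw [Set.ncard_coe_finset, Set.ncard_coe_finset] at h2
    have h3 := hL.card
    have h4 := hG S B H hL.disj hL.mem hL.walk hL.touch
    calc _ ≤ _ := h2
      _ ≤ S.card + 2 * k * (c * S.card) := by gcongr; exact h3.trans (Nat.mul_le_mul_left _ h4)
      _ = _ := by ring
  -- `A v` is the region explored from `v` through unused vertices, and `Z v` its frontier in `U`.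
  let A : V → Set V := fun v => {x | G.ReachIn O k v x}
  let Z : V → Finset V := fun v => U.filter fun z => z ≠ v ∧ ∃ x ∈ A v, G.Adj x z
  have hAmem : ∀ v, v ∈ A v := fun v => SimpleGraph.ReachIn.refl v
  have hAO : ∀ v, ∀ x ∈ A v, x = v ∨ x ∈ O := by
    rintro v x ⟨w, -, hw⟩
    exact hw x w.end_mem_support
  have hAwalk : ∀ v, ∀ x ∈ A v, ∃ w : G.Walk v x, w.length ≤ 2 * k ∧ ∀ y ∈ w.support, y ∈ A v := by
    rintro v x ⟨w, hlen, hw⟩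
    exact ⟨w, by omega, fun y hy => ⟨w.takeUntil y hy,
      (w.length_takeUntil_le_length hy).trans hlen,
      fun z hz => hw z (w.support_takeUntil_subset_support hy hz)⟩⟩
  -- Overlapping regions would give a link of length at most `2 * k`, contradicting maximality;
  -- hence the depth `2 * k`.
  have hAdisj : ∀ a ∈ R, ∀ b ∈ R, a ≠ b → Disjoint (A a) (A b) := by
    intro a ha b hb hab
    rw [Set.disjoint_left]
    rintro x ⟨p, hp, hps⟩ ⟨q, hq, hqs⟩
    obtain ⟨y, hy, hyb⟩ := SimpleGraph.exists_reachIn_adj (O := O) (n := 2 * k) hab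
      (p.append q.reverse) (by simp; omega) (fun y hy => by
        rw [SimpleGraph.Walk.mem_support_append_iff] at hy
        rcases hy with hy | hy
        · exact (hps y hy).imp id Or.inr
        · exact Or.inr (hqs y (by simpa using hy)))
    exact hnoext a (hRS ha) b (hRS hb) hab (hind a ha b hb) y hy hyb
  have hZR : ∀ a ∈ R, ∀ z ∈ Z a, z ∉ R := by
    intro a ha z hz hzR
    obtain ⟨-, hza, x, ⟨w, hw, hws⟩, hxz⟩ := Finset.mem_filter.1 hz
    exact hnoext a (hRS ha) z (hRS hzR) hza.symm (hind a ha z hzR) x ⟨w, by omega, hws⟩ hxz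
  -- A second shallow minor: regions for `R`, singletons for the rest of `U`. Its sparsity bounds
  -- the total size of the frontiers, and averaging over `R` gives `v`.
  let B' : V → Set V := fun a => if a ∈ R then A a else {a}
  obtain ⟨H', hH'⟩ : ∃ H' : SimpleGraph V, ∀ a b, H'.Adj a b ↔
      (a ∈ R ∧ b ∈ Z a) ∨ (b ∈ R ∧ a ∈ Z b) :=
    ⟨{  Adj := fun a b => (a ∈ R ∧ b ∈ Z a) ∨ (b ∈ R ∧ a ∈ Z b)
        symm := ⟨fun _ _ h => h.symm⟩
        loopless := ⟨fun a h => by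
          rcases h with h | h <;> exact (Finset.mem_filter.1 h.2).2.1 rfl⟩ }, fun _ _ => Iff.rfl⟩
  have htouch : ∀ a ∈ R, ∀ b ∈ Z a, ∃ x ∈ B' a, ∃ y ∈ B' b, G.Adj x y := by
    intro a ha b hb
    obtain ⟨-, -, x, hx, hxb⟩ := Finset.mem_filter.1 hb
    refine ⟨x, ?_, b, ?_, hxb⟩
    · simpa only [B', if_pos ha] using hx
    · simp only [B', if_neg (hZR a ha b hb), Set.mem_singleton_iff]
  have hB'mem : ∀ a, a ∈ B' a := by
    intro a
    simp only [B']
    split_ifs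
    · exact hAmem a
    · rfl
  have hcount := hG U B' H'
    (by
      intro a ha b hb hab
      by_cases haR : a ∈ R <;> by_cases hbR : b ∈ R
      · simpa only [B', if_pos haR, if_pos hbR] using hAdisj a haR b hbR hab
      · simp only [B', if_pos haR, if_neg hbR, Set.disjoint_singleton_right]
        intro h'
        exact (hAO a b h').elim (fun e => hab e.symm) (hUO b hb)
      · simp only [B', if_neg haR, if_pos hbR, Set.disjoint_singleton_left]
        intro h'
        exact (hAO b a h').elim (fun e => hab e) (hUO a ha)
      · simpa only [B', if_neg haR, if_neg hbR, Set.disjoint_singleton] using hab)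
    (fun a _ => hB'mem a)
    (by
      intro a ha x hx
      by_cases haR : a ∈ R
      · simp only [B', if_pos haR] at hx ⊢
        exact hAwalk a x hx
      · simp only [B', if_neg haR, Set.mem_singleton_iff] at hx ⊢
        subst hx
        exact ⟨.nil, by simp, by simp⟩)
    (by
      intro a ha b hb hab
      rcases (hH' a b).1 hab with ⟨h1, h2⟩ | ⟨h1, h2⟩
      · exact htouch a h1 b h2
      · obtain ⟨x, hx, y, hy, hxy⟩ := htouch b h1 a h2
        exact ⟨y, hy, x, hx, hxy.symm⟩)
  have hsum : ∑ a ∈ R, (Z a).card ≤ c * ((1 + 2 * k * c) * (c + 1)) * R.card := by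
    have h1 : ∑ a ∈ R, (Z a).card ≤ ((U ×ˢ U).filter fun p => H'.Adj p.1 p.2).card := by
      rw [← Finset.card_sigma]
      refine Finset.card_le_card_of_injOn (fun p => (p.1, p.2)) ?_ ?_
      · rintro ⟨a, b⟩ hab
        obtain ⟨h1, h2⟩ := Finset.mem_sigma.1 hab
        exact Finset.mem_filter.2 ⟨Finset.mem_product.2
          ⟨hSU a (hRS h1), (Finset.mem_filter.1 h2).1⟩, (hH' a b).2 (Or.inl ⟨h1, h2⟩)⟩
      · rintro ⟨a, b⟩ - ⟨a', b'⟩ - h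
        simpa using h
    calc _ ≤ c * U.card := h1.trans hcount
      _ ≤ c * ((1 + 2 * k * c) * ((c + 1) * R.card)) :=
        Nat.mul_le_mul_left _ (hUcard.trans (Nat.mul_le_mul_left _ hRcard))
      _ = _ := by ring
  have hRne : R.Nonempty := by
    rw [← Finset.card_pos]
    have := Finset.card_pos.2 hS
    by_contra h0
    have h0 : R.card = 0 := by omega
    rw [h0] at hRcard
    omega
  obtain ⟨v, hv, hZv⟩ : ∃ v ∈ R, (Z v).card ≤ c * ((1 + 2 * k * c) * (c + 1)) := by
    apply Finset.exists_le_of_sum_le hRne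
    rw [Finset.sum_const, smul_eq_mul, mul_comm R.card]
    exact hsum
  refine ⟨v, hRS hv, Z v, hZv, ?_⟩
  intro y hy hyv w hw
  -- The first vertex of the walk outside `O` and different from `v` lies in `Z v`; `p` is the part
  -- already traversed.
  have key : ∀ {x y : V} (q : G.Walk x y) (p : G.Walk v x), p.length + q.length ≤ k →
      (∀ z ∈ p.support, z = v ∨ z ∈ O) → y ∈ S → y ≠ v → ∃ z ∈ q.support, z ≠ v ∧ z ∈ Z v := by
    intro x y q
    induction q with
    | nil =>
      intro p _ hp hyS hyv
      rcases hp _ p.end_mem_support with h | h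
      · exact absurd h hyv
      · exact absurd hyS h.1
    | @cons x x' y h q ih =>
      intro p hlen hp hyS hyv
      rw [SimpleGraph.Walk.length_cons] at hlen
      by_cases hx' : x' = v ∨ x' ∈ O
      · obtain ⟨z, hz, hz'⟩ := ih (p.concat h)
          (by rw [SimpleGraph.Walk.length_concat]; omega)
          (by
            intro z hz
            rw [SimpleGraph.Walk.support_concat, List.mem_append] at hz
            rcases hz with hz | hz
            · exact hp z hz
            · rw [List.mem_singleton.1 hz]
              exact hx') hyS hyv
        exact ⟨z, by simp [hz], hz'⟩
      · rw [not_or] at hx'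
        refine ⟨x', by simp, hx'.1, Finset.mem_filter.2
          ⟨Finset.mem_filter.2 ⟨Finset.mem_univ _, hx'.2⟩, hx'.1, x, ⟨p, by omega, hp⟩, h⟩⟩
  exact key w .nil (by simpa using hw) (by simp) hy hyv


/-! ### Rankings with few weakly reachable vertices. -/

namespace SimpleGraph

variable {V : Type u} {G : SimpleGraph V}

/-- `u` is weakly `k`-reachable from `v` with respect to the vertex ranking `f`. -/
def WeakReach (G : SimpleGraph V) (f : V → ℕ) (k : ℕ) (v u : V) : Prop :=
  ∃ w : G.Walk v u, w.length ≤ k ∧ ∀ x ∈ w.support, f u ≤ f x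

/-- The ranking is built from the top: the vertex supplied for `S` gets the largest rank in `S`, so
the lower-ranked vertices are exactly the rest of `S`. -/
theorem exists_ranking_of_hitting [Finite V] {k M : ℕ}
    (h : ∀ S : Finset V, S.Nonempty → ∃ v ∈ S, ∃ Z : Finset V, Z.card ≤ M ∧
      ∀ y ∈ S, y ≠ v → ∀ w : G.Walk v y, w.length ≤ k → ∃ z ∈ w.support, z ≠ v ∧ z ∈ Z) :
    ∃ (f : V → ℕ) (Z : V → Finset V), f.Injective ∧ ∀ v, (Z v).card ≤ M ∧
      ∀ y, f y < f v → ∀ w : G.Walk v y, w.length ≤ k → ∃ z ∈ w.support, z ≠ v ∧ z ∈ Z v := by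
  classical
  let _ := Fintype.ofFinite V
  have key : ∀ S : Finset V, ∃ (f : V → ℕ) (Z : V → Finset V), Set.InjOn f S ∧
      (∀ v ∈ S, f v < S.card) ∧ ∀ v ∈ S, (Z v).card ≤ M ∧
      ∀ y ∈ S, f y < f v → ∀ w : G.Walk v y, w.length ≤ k →
        ∃ z ∈ w.support, z ≠ v ∧ z ∈ Z v := by
    intro S
    induction S using Finset.strongInduction with
    | H S ih =>
      rcases S.eq_empty_or_nonempty with rfl | hS
      · exact ⟨fun _ => 0, fun _ => ∅, by simp, by simp, by simp⟩
      obtain ⟨v, hv, Z₀, hZ₀, hhit⟩ := h S hS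
      obtain ⟨f, Z, hinj, hlt, hZ⟩ := ih (S.erase v) (Finset.erase_ssubset hv)
      have hcard := Finset.card_erase_add_one hv
      have hfv : ∀ x ∈ S, x ≠ v →
          Function.update f v (S.erase v).card x < (S.erase v).card := by
        intro x hx hxv
        rw [Function.update_of_ne hxv]
        exact hlt x (Finset.mem_erase.2 ⟨hxv, hx⟩)
      refine ⟨Function.update f v (S.erase v).card, Function.update Z v Z₀, ?_, ?_, ?_⟩
      · intro x hx y hy hxy
        by_cases hxv : x = v <;> by_cases hyv : y = v
        · rw [hxv, hyv]
        · have := hfv y hy hyv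
          rw [← hxy, hxv, Function.update_self] at this
          exact absurd this (lt_irrefl _)
        · have := hfv x hx hxv
          rw [hxy, hyv, Function.update_self] at this
          exact absurd this (lt_irrefl _)
        · rw [Function.update_of_ne hxv, Function.update_of_ne hyv] at hxy
          exact hinj (Finset.mem_erase.2 ⟨hxv, hx⟩) (Finset.mem_erase.2 ⟨hyv, hy⟩) hxy
      · intro x hx
        by_cases hxv : x = v
        · rw [hxv, Function.update_self]
          omega
        · have := hfv x hx hxv
          omega
      · intro x hx
        by_cases hxv : x = v
        · subst hxv
          rw [Function.update_self]
          refine ⟨hZ₀, fun y hy hyx => hhit y hy ?_⟩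
          rintro rfl
          exact lt_irrefl _ hyx
        · rw [Function.update_of_ne hxv]
          refine ⟨(hZ x (Finset.mem_erase.2 ⟨hxv, hx⟩)).1, fun y hy hyx => ?_⟩
          have hyv : y ≠ v := by
            rintro rfl
            have := hfv x hx hxv
            rw [Function.update_self, Function.update_of_ne hxv] at hyx
            rw [Function.update_of_ne hxv] at this
            omega
          rw [Function.update_of_ne hxv, Function.update_of_ne hyv] at hyx
          exact (hZ x (Finset.mem_erase.2 ⟨hxv, hx⟩)).2 y (Finset.mem_erase.2 ⟨hyv, hy⟩) hyx
  obtain ⟨f, Z, hinj, -, hZ⟩ := key Finset.univ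
  refine ⟨f, Z, fun x y hxy => hinj (by simp) (by simp) hxy, fun v => ?_⟩
  exact ⟨(hZ v (Finset.mem_univ v)).1, fun y => (hZ v (Finset.mem_univ v)).2 y (Finset.mem_univ y)⟩

/-- A walk from `v` to a lower vertex `u` meets some `z ∈ Z v` other than `v`, and its remainder is
a shorter walk witnessing that `z` weakly reaches `u`. So the bound grows by a factor `M + 1` per
step. -/
theorem weakReach_bound_of_hitting {k M : ℕ} {f : V → ℕ} {Z : V → Finset V}
    (hf : f.Injective) (hM : ∀ v, (Z v).card ≤ M)
    (hZ : ∀ v y, f y < f v → ∀ w : G.Walk v y, w.length ≤ k →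
      ∃ z ∈ w.support, z ≠ v ∧ z ∈ Z v) :
    ∀ n ≤ k, ∀ v, ∃ W : Finset V, W.card ≤ (M + 1) ^ n ∧ ∀ u, G.WeakReach f n v u → u ∈ W := by
  classical
  intro n
  induction n with
  | zero =>
    rintro - v
    refine ⟨{v}, by simp, ?_⟩
    rintro u ⟨w, hw, -⟩
    rw [Finset.mem_singleton]
    exact (w.eq_of_length_eq_zero (by omega)).symm
  | succ n ih =>
    intro hn v
    choose W hWc hW using ih (by omega)
    refine ⟨insert v ((Z v).biUnion W), ?_, ?_⟩
    · have h1 := Finset.card_biUnion_le_card_mul (Z v) W _ (fun z _ => hWc z)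
      have h2 := Finset.card_insert_le v ((Z v).biUnion W)
      have h3 := Nat.mul_le_mul_right ((M + 1) ^ n) (hM v)
      have h4 : 1 ≤ (M + 1) ^ n := Nat.one_le_pow _ _ (by omega)
      rw [pow_succ]
      nlinarith
    · rintro u ⟨w, hw, hmin⟩
      by_cases huv : u = v
      · simp [huv]
      have hlt : f u < f v :=
        lt_of_le_of_ne (hmin v w.start_mem_support) (fun h => huv (hf h))
      obtain ⟨z, hz, hzv, hzZ⟩ := hZ v u hlt w (by omega)
      refine Finset.mem_insert_of_mem (Finset.mem_biUnion.2 ⟨z, hzZ, hW z u ⟨w.dropUntil z hz, ?_,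
        fun x hx => hmin x (w.support_dropUntil_subset_support hz hx)⟩⟩)
      have := w.length_dropUntil_lt_length hz hzv
      omega

/-- Boundedness of the weak colouring numbers, with one ranking per length `k`. -/
theorem _root_.BoundedExpansion.exists_ranking {C : Set FinGraph.{u}} (hC : BoundedExpansion C)
    (k : ℕ) : ∃ M : ℕ, ∀ G ∈ C, ∃ (f : G.V → ℕ) (W : G.V → Finset G.V), f.Injective ∧
      (∀ v, (W v).card ≤ M) ∧ ∀ v u, G.graph.WeakReach f k v u → u ∈ W v := by
  obtain ⟨c, hc⟩ := hC.exists_minorSparse (2 * k)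
  refine ⟨(c * ((1 + 2 * k * c) * (c + 1)) + 1) ^ k, fun G hG => ?_⟩
  obtain ⟨f, Z, hf, hZ⟩ := exists_ranking_of_hitting
    (fun S hS => (hc G hG).exists_hitting hS)
  choose W hWc hW using weakReach_bound_of_hitting hf (fun v => (hZ v).1) (fun v => (hZ v).2) k le_rfl
  exact ⟨f, W, hf, hWc, hW⟩

/-- Greedy colouring along a ranking. -/
theorem exists_greedy_coloring [Finite V] (f : V → ℕ) (W : V → Finset V) {M : ℕ}
    (hM : ∀ v, (W v).card ≤ M) :
    ∃ c : V → Fin (M + 1), ∀ v, ∀ u ∈ W v, f u < f v → c u ≠ c v := by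
  classical
  have key : ∀ n, ∃ c : V → Fin (M + 1), ∀ v, f v < n → ∀ u ∈ W v, f u < f v → c u ≠ c v := by
    intro n
    induction n with
    | zero => exact ⟨fun _ => 0, by simp⟩
    | succ n ih =>
      obtain ⟨c, hc⟩ := ih
      have fresh : ∀ v, ∃ x : Fin (M + 1), x ∉ (W v).image c := by
        intro v
        by_contra! hcon
        have h1 : (Finset.univ : Finset (Fin (M + 1))).card ≤ ((W v).image c).card :=
          Finset.card_le_card fun x _ => hcon x
        have h2 := h1.trans (Finset.card_image_le.trans (hM v))
        simp at h2
      choose x hx using fresh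
      -- All vertices of rank at least `n` are recoloured, but only those of rank exactly `n` matter
      -- at this stage.
      refine ⟨fun v => if f v < n then c v else x v, fun v hv u hu huv => ?_⟩
      by_cases hvn : f v < n
      · simp only [if_pos hvn, if_pos (huv.trans hvn)]
        exact hc v hvn u hu huv
      · simp only [if_neg hvn, if_pos (show f u < n by omega)]
        intro h
        exact hx v (h ▸ Finset.mem_image_of_mem c hu)
  obtain ⟨b, hb⟩ := (Set.finite_range f).bddAbove
  obtain ⟨c, hc⟩ := key (b + 1)
  exact ⟨c, fun v => hc v (Nat.lt_succ_of_le (hb ⟨v, rfl⟩))⟩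

/-! ### Few colours give linear orders with small boundaries. -/

open Classical in
/-- The vertices of `Y` ranked below `n` that have a neighbour in `Y` of rank at least `n`. -/
noncomputable def cutBoundary (G : SimpleGraph V) (Y : Finset V) (g : V → ℕ) (n : ℕ) : Finset V :=
  Y.filter fun u => g u < n ∧ ∃ v ∈ Y, n ≤ g v ∧ G.Adj u v

theorem mem_cutBoundary {Y : Finset V} {g : V → ℕ} {n : ℕ} {u : V} :
    u ∈ G.cutBoundary Y g n ↔ u ∈ Y ∧ g u < n ∧ ∃ v ∈ Y, n ≤ g v ∧ G.Adj u v := by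
  classical
  simp [cutBoundary]

section Centered

variable [DecidableEq V] {α : Type*} [DecidableEq α] {f : V → ℕ} {K : ℕ} {c : V → α}

/-- If vertices weakly reachable from each other get different colours, then paths with at least
`2 ^ s` vertices have more than `s` colours. -/
theorem lt_card_image_support_of_isPath
    (hc : ∀ v u, u ≠ v → G.WeakReach f K v u → c u ≠ c v) (s : ℕ) (hK : 2 * 2 ^ s ≤ K)
    {a b : V} (w : G.Walk a b) (hw : w.IsPath) (hlen : 2 ^ s ≤ w.length + 1) :
    s < (w.support.toFinset.image c).card := by
  induction s generalizing a b w with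
  | zero =>
    rw [Finset.card_pos, Finset.image_nonempty]
    exact ⟨a, by simp⟩
  | succ s ih =>
    have hpos : 1 ≤ 2 ^ s := Nat.one_le_two_pow
    rw [pow_succ] at hK hlen
    obtain ⟨b', p, hp, hplen, hpsup⟩ : ∃ (b' : V) (p : G.Walk a b'), p.IsPath ∧
        p.length = 2 ^ s * 2 - 1 ∧ ∀ x ∈ p.support, x ∈ w.support :=
      ⟨_, w.take (2 ^ s * 2 - 1), hw.take _, by rw [Walk.take_length]; omega,
        fun x hx => (w.isSubwalk_take _).support_subset hx⟩
    obtain ⟨m, hm, hmin⟩ := Finset.exists_min_image p.support.toFinset f ⟨a, by simp⟩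
    simp only [List.mem_toFinset] at hm hmin
    -- The lowest vertex `m` is reached from `x` by going back to the start of `p`, then forward;
    -- this detour accounts for the factor 2 in `hK`.
    have hcm : ∀ x ∈ p.support, x ≠ m → c x ≠ c m := by
      intro x hx hxm
      refine (hc x m hxm.symm ⟨(p.takeUntil x hx).reverse.append (p.takeUntil m hm), ?_, ?_⟩).symm
      · have h1 := p.length_takeUntil_le_length hx
        have h2 := p.length_takeUntil_le_length hm
        rw [Walk.length_append, Walk.length_reverse]
        omega
      · intro y hy
        rw [Walk.mem_support_append_iff] at hy
        rcases hy with hy | hy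
        · exact hmin y (p.support_takeUntil_subset_support hx (by simpa using hy))
        · exact hmin y (p.support_takeUntil_subset_support hm hy)
    have key : ∀ {d : V} (q : G.Walk m d), q.IsPath → 2 ^ s ≤ q.length →
        (∀ x ∈ q.support, x ∈ p.support) → s + 1 < (w.support.toFinset.image c).card := by
      intro d q hq hqlen hqsup
      cases q with
      | nil => rw [Walk.length_nil] at hqlen; omega
      | cons h q =>
        rw [Walk.cons_isPath_iff] at hq
        have h1 := ih (by omega) q hq.1 (by simpa using hqlen)
        have h2 : c m ∉ q.support.toFinset.image c := by
          intro h'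
          obtain ⟨x, hx, hxm⟩ := Finset.mem_image.1 h'
          rw [List.mem_toFinset] at hx
          exact hcm x (hqsup x (by simp [hx])) (fun e => hq.2 (e ▸ hx)) hxm
        have h3 : insert (c m) (q.support.toFinset.image c) ⊆ w.support.toFinset.image c := by
          rw [Finset.insert_subset_iff]
          refine ⟨Finset.mem_image_of_mem c (by simpa using hpsup m hm), ?_⟩
          apply Finset.image_subset_image
          intro x hx
          rw [List.mem_toFinset] at hx ⊢
          exact hpsup x (hqsup x (by simp [hx]))
        have h4 := Finset.card_le_card h3
        rw [Finset.card_insert_of_notMem h2] at h4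
        omega
    have hsum : (p.takeUntil m hm).length + (p.dropUntil m hm).length = p.length := by
      rw [← Walk.length_append, p.take_spec hm]
    -- The two sides of `m` have `2 ^ (s + 1) - 1` vertices together, so one has at least `2 ^ s`;
    -- it avoids the colour of `m`.
    by_cases hcase : 2 ^ s ≤ (p.dropUntil m hm).length
    · exact key _ (hp.dropUntil hm) hcase
        (fun x hx => p.support_dropUntil_subset_support hm hx)
    · refine key (p.takeUntil m hm).reverse (hp.takeUntil hm).reverse ?_
        (fun x hx => p.support_takeUntil_subset_support hm (by simpa using hx))
      rw [Walk.length_reverse]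
      omega


/-- If `Y` splits into parts without edges between them, the parts are ordered one after the other.
If `Y` is connected, its lowest vertex has a unique colour and is placed first: it adds at most one
boundary vertex while the number of colours drops. -/
theorem exists_ranking_cutBoundary_le {t : ℕ}
    (hc : ∀ v u, u ≠ v → G.WeakReach f K v u → c u ≠ c v) (hK : 2 * 2 ^ t ≤ K) (Y : Finset V)
    (hY : (Y.image c).card ≤ t) :
    ∃ g : V → ℕ, Set.InjOn g Y ∧ ∀ n, (G.cutBoundary Y g n).card ≤ (Y.image c).card := by
  induction Y using Finset.strongInduction with
  | H Y ih =>
    rcases Y.eq_empty_or_nonempty with rfl | hne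
    · exact ⟨fun _ => 0, by simp, by simp [cutBoundary]⟩
    by_cases hsplit : ∃ A ⊆ Y, A.Nonempty ∧ A ≠ Y ∧ ∀ a ∈ A, ∀ b ∈ Y, G.Adj a b → b ∈ A
    · obtain ⟨A, hAY, hAne, hAY', hA⟩ := hsplit
      have hmono : ∀ B ⊆ Y, (B.image c).card ≤ (Y.image c).card := fun B hB =>
        Finset.card_le_card (Finset.image_subset_image hB)
      obtain ⟨gA, hgA, hbA⟩ := ih A (Finset.ssubset_iff_subset_ne.2 ⟨hAY, hAY'⟩)
        ((hmono A hAY).trans hY)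
      have hsd : Y \ A ⊂ Y := Finset.sdiff_ssubset hAY hAne
      obtain ⟨gB, hgB, hbB⟩ := ih (Y \ A) hsd ((hmono _ hsd.subset).trans hY)
      obtain ⟨N, hN⟩ : ∃ N, ∀ a ∈ A, gA a < N :=
        ⟨A.sup gA + 1, fun a ha => Nat.lt_succ_of_le (Finset.le_sup ha)⟩
      refine ⟨fun u => if u ∈ A then gA u else N + gB u, ?_, fun n => ?_⟩
      · intro x hx y hy hxy
        by_cases hxA : x ∈ A <;> by_cases hyA : y ∈ A
        · simp only [if_pos hxA, if_pos hyA] at hxy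
          exact hgA hxA hyA hxy
        · simp only [if_pos hxA, if_neg hyA] at hxy
          have := hN x hxA
          omega
        · simp only [if_neg hxA, if_pos hyA] at hxy
          have := hN y hyA
          omega
        · simp only [if_neg hxA, if_neg hyA] at hxy
          refine hgB ?_ ?_ (by omega)
          · simpa using ⟨hx, hxA⟩
          · simpa using ⟨hy, hyA⟩
      · by_cases hn : n ≤ N
        · refine (Finset.card_le_card ?_).trans ((hbA n).trans (hmono A hAY))
          intro u hu
          rw [mem_cutBoundary] at hu ⊢
          obtain ⟨huY, hun, v, hv, hnv, huv⟩ := hu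
          have huA : u ∈ A := by
            by_contra h
            simp only [if_neg h] at hun
            omega
          have hvA := hA u huA v hv huv
          simp only [if_pos huA, if_pos hvA] at hun hnv
          exact ⟨huA, hun, v, hvA, hnv, huv⟩
        · refine (Finset.card_le_card ?_).trans ((hbB (n - N)).trans (hmono _ hsd.subset))
          intro u hu
          rw [mem_cutBoundary] at hu ⊢
          obtain ⟨huY, hun, v, hv, hnv, huv⟩ := hu
          have hvA : v ∉ A := by
            intro h
            simp only [if_pos h] at hnv
            have := hN v h
            omega
          have huA : u ∉ A := fun h => hvA (hA u h v hv huv)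
          simp only [if_neg huA, if_neg hvA] at hun hnv
          exact ⟨Finset.mem_sdiff.2 ⟨huY, huA⟩, by omega, v, Finset.mem_sdiff.2 ⟨hv, hvA⟩,
            by omega, huv⟩
    · obtain ⟨m, hm, hmin⟩ := Finset.exists_min_image Y f hne
      have hconn : ∀ x ∈ Y, ∃ w : G.Walk x m, ∀ y ∈ w.support, y ∈ Y := by
        by_contra! hcon
        classical
        obtain ⟨x, hx, hxw⟩ := hcon
        refine hsplit ⟨Y.filter fun x => ∃ w : G.Walk x m, ∀ y ∈ w.support, y ∈ Y,
          Finset.filter_subset _ _, ⟨m, Finset.mem_filter.2 ⟨hm, .nil, by simpa using hm⟩⟩, ?_, ?_⟩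
        · intro h
          rw [← h] at hx
          obtain ⟨w, hw⟩ := (Finset.mem_filter.1 hx).2
          obtain ⟨y, hy, hyY⟩ := hxw w
          exact hyY (hw y hy)
        · intro a ha b hb hab
          obtain ⟨haY, w, hw⟩ := Finset.mem_filter.1 ha
          refine Finset.mem_filter.2 ⟨hb, .cons hab.symm w, ?_⟩
          intro y hy
          rw [Walk.support_cons, List.mem_cons] at hy
          rcases hy with rfl | hy
          · exact hb
          · exact hw y hy
      have hcm : ∀ x ∈ Y, x ≠ m → c x ≠ c m := by
        intro x hx hxm
        obtain ⟨w, hw⟩ := hconn x hx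
        have hsup : ∀ y ∈ w.bypass.support, y ∈ Y :=
          fun y hy => hw y (w.support_bypass_subset_support hy)
        -- A path longer than `K` would carry more than `t` colours, so `m` is weakly reachable from
        -- every `x`.
        refine (hc x m hxm.symm ⟨w.bypass, ?_, fun y hy => hmin y (hsup y hy)⟩).symm
        by_contra hlen
        have h1 := lt_card_image_support_of_isPath hc t hK w.bypass w.bypass_isPath (by omega)
        have h2 : (w.bypass.support.toFinset.image c).card ≤ (Y.image c).card :=
          Finset.card_le_card (Finset.image_subset_image
            fun y hy => hsup y (List.mem_toFinset.1 hy))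
        omega
      have hlt : ((Y.erase m).image c).card + 1 ≤ (Y.image c).card := by
        have h1 : c m ∉ (Y.erase m).image c := by
          intro h
          obtain ⟨x, hx, hxm⟩ := Finset.mem_image.1 h
          exact hcm x (Finset.mem_of_mem_erase hx) (Finset.ne_of_mem_erase hx) hxm
        rw [← Finset.card_insert_of_notMem h1, ← Finset.image_insert, Finset.insert_erase hm]
      obtain ⟨g, hg, hb⟩ := ih (Y.erase m) (Finset.erase_ssubset hm) (by omega)
      refine ⟨fun u => if u = m then 0 else g u + 1, ?_, fun n => ?_⟩
      · intro x hx y hy hxy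
        by_cases hxm : x = m <;> by_cases hym : y = m
        · rw [hxm, hym]
        · simp [hxm, hym] at hxy
        · simp [hxm, hym] at hxy
        · simp only [if_neg hxm, if_neg hym] at hxy
          refine hg ?_ ?_ (by omega)
          · simpa using ⟨hx, hxm⟩
          · simpa using ⟨hy, hym⟩
      · have hsub : G.cutBoundary Y (fun u => if u = m then 0 else g u + 1) n ⊆
            insert m (G.cutBoundary (Y.erase m) g (n - 1)) := by
          intro u hu
          rw [mem_cutBoundary] at hu
          obtain ⟨huY, hun, v, hv, hnv, huv⟩ := hu
          by_cases hum : u = m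
          · simp [hum]
          apply Finset.mem_insert_of_mem
          rw [mem_cutBoundary]
          simp only [if_neg hum] at hun
          have hvm : v ≠ m := by
            intro h
            simp only [if_pos h] at hnv
            omega
          simp only [if_neg hvm] at hnv
          exact ⟨Finset.mem_erase.2 ⟨hum, huY⟩, by omega, v, Finset.mem_erase.2 ⟨hvm, hv⟩,
            by omega, huv⟩
        have h1 := (Finset.card_le_card hsub).trans (Finset.card_insert_le _ _)
        have h2 := hb (n - 1)
        omega

end Centered

end SimpleGraph


/-! ### Rank-width of induced subgraphs of the power. -/

namespace SimpleGraph

variable {V : Type u} {G : SimpleGraph V}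

/-- A walk that starts below rank `n` and ends at rank at least `n` meets the boundary. -/
theorem exists_mem_support_cutBoundary {Y : Finset V} {g : V → ℕ} {n : ℕ} {a b : V}
    (w : G.Walk a b) (hw : ∀ y ∈ w.support, y ∈ Y) (ha : g a < n) (hb : n ≤ g b) :
    ∃ s ∈ w.support, s ∈ G.cutBoundary Y g n := by
  induction w with
  | nil => omega
  | @cons a x b h p ih =>
    by_cases hx : g x < n
    · obtain ⟨s, hs, hs'⟩ := ih (fun y hy => hw y (by simp [hy])) hx hb
      exact ⟨s, by simp [hs], hs'⟩
    · exact ⟨a, by simp, mem_cutBoundary.2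
        ⟨hw a (by simp), ha, x, hw x (by simp), not_lt.1 hx, h⟩⟩

/-- If distances up to `r` between vertices of `X` are realised inside `Y`, and `Y` has a ranking
with small boundaries, then `X` induces a subgraph of small rank-width in the `r`-th power. -/
theorem rankWidth_induce_distPower_le [Finite V] {r t : ℕ} {X : Set V} {Y : Finset V}
    (hXY : ∀ x ∈ X, x ∈ Y) {g : V → ℕ} (hg : Set.InjOn g Y)
    (hb : ∀ n, (G.cutBoundary Y g n).card ≤ t)
    (hd : ∀ u ∈ X, ∀ v ∈ X, G.edist u v ≤ r →
      ∃ w : G.Walk u v, w.length ≤ r ∧ ∀ y ∈ w.support, y ∈ Y) :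
    ((G.distPower r).induce X).rankWidth ≤ (((2 ^ (r + 1)) ^ t : ℕ) : ℕ∞) := by
  classical
  let _ := Fintype.ofFinite V
  have hinj : Function.Injective fun x : X => g x := fun x y hxy =>
    Subtype.ext (hg (hXY x x.2) (hXY y y.2) hxy)
  let _ : LinearOrder X := LinearOrder.lift' (fun x : X => g x) hinj
  let e : X ≃o Fin (Fintype.card X) := (Fintype.orderIsoFinOfCardEq X rfl).symm
  have hle : ∀ x y : X, e x < e y ↔ g x < g y := fun x y => e.lt_iff_lt
  have hcut : ∀ n, ((G.distPower r).induce X).cutRank {x | g x < n} ≤ (2 ^ (r + 1)) ^ t := by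
    intro n
    let S := G.cutBoundary Y g n
    -- The type of `x` records, for each boundary vertex, the lengths up to `r` of walks inside `Y`
    -- to it: `2 ^ (r + 1)` possibilities each.
    let φ : X → (S → Finset (Fin (r + 1))) := fun x s => Finset.univ.filter fun l =>
      ∃ w : G.Walk x s, w.length = l ∧ ∀ y ∈ w.support, y ∈ Y
    let P : (S → Finset (Fin (r + 1))) → X → Prop := fun F y => ∃ s : S, ∃ l ∈ F s,
      ∃ w : G.Walk s y, l.val + w.length ≤ r
    refine (cutRank_le_card _ _ φ P ?_).trans ?_
    · intro x hx y hy
      have hx : g x < n := hx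
      have hy : n ≤ g y := not_lt.1 hy
      constructor
      · rintro ⟨-, hxy⟩
        obtain ⟨w, hw, hwY⟩ := hd x x.2 y y.2 hxy
        obtain ⟨s, hs, hsS⟩ := exists_mem_support_cutBoundary w hwY hx hy
        have hsum : (w.takeUntil s hs).length + (w.dropUntil s hs).length = w.length := by
          rw [← Walk.length_append, w.take_spec hs]
        refine ⟨⟨s, hsS⟩, ⟨(w.takeUntil s hs).length, by omega⟩,
          Finset.mem_filter.2 ⟨Finset.mem_univ _, w.takeUntil s hs, rfl,
            fun z hz => hwY z (w.support_takeUntil_subset_support hs hz)⟩,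
          w.dropUntil s hs, ?_⟩
        simp only
        omega
      · rintro ⟨s, l, hl, w, hw⟩
        obtain ⟨-, w', hw', -⟩ := Finset.mem_filter.1 hl
        refine ⟨?_, (w'.append w).edist_le.trans ?_⟩
        · intro hxy
          have hxy : (x : V) = y := hxy
          rw [hxy] at hx
          omega
        · rw [Walk.length_append]
          exact_mod_cast (by omega : w'.length + w.length ≤ r)
    · rw [Fintype.card_fun, Fintype.card_finset, Fintype.card_fin, Fintype.card_coe]
      exact Nat.pow_le_pow_right (Nat.pos_of_ne_zero (by positivity)) (hb n)
  refine rankWidth_le_of_equiv _ e.toEquiv (Nat.one_le_iff_ne_zero.2 (by positivity)) ?_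
  intro i
  by_cases hi : i < Fintype.card X
  · refine le_trans (le_of_eq ?_) (hcut (g (e.symm ⟨i, hi⟩)))
    congr 1
    ext x
    have := hle x (e.symm ⟨i, hi⟩)
    rw [OrderIso.apply_symm_apply] at this
    exact this
  -- Beyond the last position the initial segment is all of `X`, which any threshold above every
  -- rank also cuts out.
  · obtain ⟨b, hb'⟩ := (Set.finite_range g).bddAbove
    refine le_trans (le_of_eq ?_) (hcut (b + 1))
    congr 1
    ext x
    refine iff_of_true ?_ (Nat.lt_succ_of_le (hb' ⟨x, rfl⟩))
    exact (e x).2.trans_le (not_lt.1 hi)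

/-- A small set containing a shortest walk between two vertices at distance at most `r`. -/
theorem exists_geodesic_finset (G : SimpleGraph V) (r : ℕ) (a b : V) :
    ∃ T : Finset V, T.card ≤ r + 1 ∧ ∀ w : G.Walk a b, w.length ≤ r →
      ∃ w' : G.Walk a b, w'.length ≤ w.length ∧ ∀ y ∈ w'.support, y ∈ T := by
  classical
  by_cases h : ∃ w : G.Walk a b, w.length ≤ r
  · obtain ⟨w, hw⟩ := h
    obtain ⟨p, hp⟩ := w.reachable.exists_walk_length_eq_dist
    refine ⟨p.support.toFinset, ?_, fun q _ => ⟨p, ?_, by simp⟩⟩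
    · refine (List.toFinset_card_le _).trans ?_
      have := dist_le w
      rw [Walk.length_support]
      omega
    · rw [hp]
      exact dist_le q
  · push Not at h
    exact ⟨∅, by simp, fun w hw => absurd hw (not_le.2 (h w))⟩

/-- Given a ranking with few weakly `r`-reachable vertices, every vertex has a small closure such
that distances up to `r` are realised within the union of the closures of the two endpoints. -/
theorem exists_closure (G : SimpleGraph V) (r : ℕ) {f : V → ℕ} {W : V → Finset V} {M : ℕ}
    (hM : ∀ v, (W v).card ≤ M) (hW : ∀ v u, G.WeakReach f r v u → u ∈ W v) :
    ∃ cl : V → Finset V, (∀ v, (cl v).card ≤ M * (r + 1)) ∧ (∀ v, v ∈ cl v) ∧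
      ∀ u v, G.edist u v ≤ r → ∃ w : G.Walk u v, w.length ≤ r ∧
        ∀ y ∈ w.support, y ∈ cl u ∨ y ∈ cl v := by
  classical
  choose T hT hTw using G.exists_geodesic_finset r
  have hcl : ∀ v m, m ∈ W v → ∀ y ∈ T v m, y ∈ (W v).biUnion (T v) := fun v m hm y hy =>
    Finset.mem_biUnion.2 ⟨m, hm, hy⟩
  refine ⟨fun v => (W v).biUnion (T v), fun v => ?_, fun v => ?_, fun u v huv => ?_⟩
  · exact (Finset.card_biUnion_le_card_mul _ _ _ (fun m _ => hT v m)).trans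
      (Nat.mul_le_mul_right _ (hM v))
  · obtain ⟨w, -, hw⟩ := hTw v v .nil (by simp)
    exact hcl v v (hW v v ⟨.nil, by simp, by simp⟩) v (hw v w.start_mem_support)
  · obtain ⟨w, hw⟩ := exists_walk_of_edist_ne_top
      (ne_of_lt (huv.trans_lt (ENat.natCast_lt_top r)))
    have hwr : w.length ≤ r := by rw [← hw] at huv; exact_mod_cast huv
    -- Both halves of `w` at its lowest vertex `m` are replaced by the fixed shortest walks from `u`
    -- and `v` to `m`.
    obtain ⟨m, hm, hmin⟩ := Finset.exists_min_image w.support.toFinset f ⟨u, by simp⟩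
    simp only [List.mem_toFinset] at hm hmin
    have hsum : (w.takeUntil m hm).length + (w.dropUntil m hm).length = w.length := by
      rw [← Walk.length_append, w.take_spec hm]
    have hmu : m ∈ W u := hW u m ⟨w.takeUntil m hm, by omega,
      fun x hx => hmin x (w.support_takeUntil_subset_support hm hx)⟩
    have hmv : m ∈ W v := hW v m ⟨(w.dropUntil m hm).reverse, by
      rw [Walk.length_reverse]; omega,
      fun x hx => hmin x (w.support_dropUntil_subset_support hm (by simpa using hx))⟩
    obtain ⟨p, hp, hpT⟩ := hTw u m (w.takeUntil m hm) (by omega)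
    obtain ⟨q, hq, hqT⟩ := hTw v m (w.dropUntil m hm).reverse (by
      rw [Walk.length_reverse]; omega)
    rw [Walk.length_reverse] at hq
    refine ⟨p.append q.reverse, ?_, ?_⟩
    · rw [Walk.length_append, Walk.length_reverse]
      omega
    · intro y hy
      rw [Walk.mem_support_append_iff] at hy
      rcases hy with hy | hy
      · exact Or.inl (hcl u m hmu y (hpT y hy))
      · exact Or.inr (hcl v m hmv y (hqT y (by simpa using hy)))

end SimpleGraph

/-! ### Assembling the colourings. -/

/-- For fixed `p`, the `r`-th powers have colourings with a bounded number of colours in which sets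
with at most `p` colours induce subgraphs of bounded rank-width. -/
theorem BoundedExpansion.exists_coloring_power {C : Set FinGraph.{u}} (hC : BoundedExpansion C)
    (r p : ℕ) : ∃ N Q : ℕ, ∀ G ∈ C, ∃ d : G.V → Fin N, ∀ X : Set G.V, (d '' X).ncard ≤ p →
      ((G.graph.distPower r).induce X).rankWidth ≤ (Q : ℕ∞) := by
  classical
  obtain ⟨M, hM⟩ := hC.exists_ranking r
  -- At most `p` colour sets, each of size at most that of a closure. Only now can the second
  -- ranking be chosen, as its length depends on `t`.
  let t := p * (M * (r + 1))
  obtain ⟨M', hM'⟩ := hC.exists_ranking (2 * 2 ^ t)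
  refine ⟨Fintype.card (Finset (Fin (M' + 1))), (2 ^ (r + 1)) ^ t, fun G hG => ?_⟩
  let _ := Fintype.ofFinite G.V
  obtain ⟨f, W, -, hWM, hW⟩ := hM G hG
  obtain ⟨f', W', hf', hWM', hW'⟩ := hM' G hG
  obtain ⟨cl, hcl, hself, hdist⟩ := G.graph.exists_closure r hWM hW
  obtain ⟨c, hc⟩ := SimpleGraph.exists_greedy_coloring f' W' hWM'
  have hc' : ∀ v u, u ≠ v → G.graph.WeakReach f' (2 * 2 ^ t) v u → c u ≠ c v := by
    intro v u huv h
    refine hc v u (hW' v u h) (lt_of_le_of_ne ?_ fun h' => huv (hf' h'))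
    obtain ⟨w, -, hw⟩ := h
    exact hw v w.start_mem_support
  refine ⟨fun v => Fintype.equivFin _ ((cl v).image c), fun X hX => ?_⟩
  let Y : Finset G.V := Finset.univ.filter fun y => ∃ x ∈ X, y ∈ cl x
  have hclY : ∀ x ∈ X, ∀ y ∈ cl x, y ∈ Y := fun x hx y hy =>
    Finset.mem_filter.2 ⟨Finset.mem_univ _, x, hx, hy⟩
  have hYcard : (Y.image c).card ≤ t := by
    let I : Finset (Finset (Fin (M' + 1))) := X.toFinset.image fun v => (cl v).image c
    have hI : I.card ≤ p := by
      refine le_trans (le_of_eq ?_) hX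
      rw [← Set.image_image (fun s => Fintype.equivFin _ s) (fun v => (cl v).image c),
        Set.ncard_image_of_injective _ (Equiv.injective _), ← Set.ncard_coe_finset]
      simp [I]
    have hsub : Y.image c ⊆ I.biUnion id := by
      intro y hy
      obtain ⟨z, hz, rfl⟩ := Finset.mem_image.1 hy
      obtain ⟨-, x, hx, hzx⟩ := Finset.mem_filter.1 hz
      refine Finset.mem_biUnion.2 ⟨(cl x).image c, ?_, Finset.mem_image_of_mem c hzx⟩
      exact Finset.mem_image.2 ⟨x, by simpa using hx, rfl⟩
    refine (Finset.card_le_card hsub).trans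
      ((Finset.card_biUnion_le_card_mul I id (M * (r + 1)) ?_).trans (Nat.mul_le_mul_right _ hI))
    intro s hs
    obtain ⟨x, -, rfl⟩ := Finset.mem_image.1 hs
    exact Finset.card_image_le.trans (hcl x)
  obtain ⟨g, hg, hb⟩ := SimpleGraph.exists_ranking_cutBoundary_le hc' le_rfl Y hYcard
  refine SimpleGraph.rankWidth_induce_distPower_le (fun x hx => hclY x hx x (hself x)) hg
    (fun n => (hb n).trans hYcard) ?_
  intro u hu v hv huv
  obtain ⟨w, hw, hwcl⟩ := hdist u v huv
  exact ⟨w, hw, fun y hy => (hwcl y hy).elim (hclY u hu y) (hclY v hv y)⟩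

theorem mainTheorem1 (C : Set FinGraph.{u}) (hC : BoundedExpansion C) (r : ℕ) (hr : 2 ≤ r) :
    AdmitsLowRankWidthColorings (FinGraph.power r '' C) := by
  classical
  choose N Q hNQ using hC.exists_coloring_power r
  -- The rank-width bound must depend on the number `i` of classes and not on `p`, so the product of
  -- the colourings for all `i ≤ p` is used; `i` product colours have at most `i` distinct `i`-th
  -- coordinates.
  refine ⟨fun p => Fintype.card (∀ i : Fin (p + 1), Fin (N i)), Q, fun p => ?_⟩
  rintro _ ⟨G, hG, rfl⟩
  choose d hd using fun i => hNQ i G hG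
  let e := Fintype.equivFin (∀ i : Fin (p + 1), Fin (N i))
  refine ⟨fun v => e fun i => d i v, fun I hI => ?_⟩
  refine hd I.card {v | e (fun i => d i v) ∈ I} ?_
  let i : Fin (p + 1) := ⟨I.card, by omega⟩
  have hsub : d I.card '' {v | e (fun i => d i v) ∈ I} ⊆
      ((I.image fun x => e.symm x i : Finset (Fin (N I.card))) : Set (Fin (N I.card))) := by
    rintro _ ⟨v, hv, rfl⟩
    rw [Finset.coe_image]
    exact ⟨e fun i => d i v, hv, by simp [i]⟩
  refine (Set.ncard_le_ncard hsub (Set.toFinite _)).trans ?_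
  rw [Set.ncard_coe_finset]
  exact Finset.card_image_le
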